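/- Let $\nu>0$ and $\theta\in\mathbb{R}$, and let $X$ have the skew Variance-Gamma distribution with $\mu=0$, $\sigma=1$, that is, $X\mid Y\sim N(\theta Y, Y)$ where $Y\sim\Gamma(1/\nu,1/\nu)$ (shape $1/\nu$, rate $1/\nu$). Let $g$ be the cumulative distribution function of $X$ and let $h(u)=\inf\{x\in\mathbb{R}: g(x)\ge u\}$, $0<u<1$, be its quantile function. Put $$c=\sqrt{\tfrac{2}{\nu}+\theta^2}+\theta,\qquad a=\frac{1}{\nu^{1/\nu}\,\Gamma(1/\nu)\,\left(\tfrac{2}{\nu}+\theta^2\right)^{1/(2\nu)}\,c},$$ $$y(u)=\frac1c\log\left(\frac{u}{a}\left(\frac{c}{\left|\log\left[u\left(\frac{c}{|1/\nu-1|}\right)^{1/\nu-1}\right]\right|}\right)^{1/\nu-1}\right),$$ where for $\nu=1$ the powers with exponent $1/\nu-1=0$ are read as $1$, so that then $y(u)=\frac1c\log\frac ua$. Then: (i) $h$ is the inverse function of $g$: for $0<u<1$ and $x\in\mathbb{R}$, $h(u)=x$ if and only if $g(x)=u$. (ii) $g$ has a Gamma-type lower tail: $g(x)=a|x|^{\frac1\nu-1}e^{-c|x|}\left(1+O\left(\frac1{|x|}\right)\right)$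 as $x\to-\infty$. (iii) $h(u)=y(u)\left(1+O\left(\frac{\log|\log u|}{(\log u)^2}\right)\right)$ as $u\to0^+$. (iv) As $u\to0^+$, $$h(u)=\frac{\log u}{c}-\frac{\left(\frac1\nu-1\right)\log|\log u|}{c}+\frac{\left(\frac1\nu-1\right)\log c-\log a}{c}+O\left(\frac{\log|\log u|}{|\log u|}\right).$$ The constants implied by the $O$-terms may depend on $\nu$ and $\theta$. -/

import Mathlib

open Filter Topology MeasureTheory ProbabilityTheory Asymptotics

noncomputable section

/-- The skew Variance-Gamma law with parameters `μ`, `θ`, `σ`, `ν`: the law of a real random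
variable `X` with `X | Y ∼ N(μ + θ Y, σ² Y)`, where `Y ∼ Γ(1/ν, 1/ν)` (shape `1/ν`, rate `1/ν`).
The second argument of `gaussianReal` is the variance. -/
def varianceGamma (μ θ σ ν : ℝ) : Measure ℝ :=
  (gammaMeasure (1 / ν) (1 / ν)).bind
    (fun y => gaussianReal (μ + θ * y) (σ ^ 2 * y).toNNReal)

/-- The mixing map is measurable, so the mixture in `varianceGamma` is a genuine one. -/
lemma measurable_varianceGamma_mixing (μ θ σ : ℝ) :
    Measurable (fun y : ℝ => gaussianReal (μ + θ * y) (σ ^ 2 * y).toNNReal) :=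
  measurable_gaussianReal.comp
    (f := fun y : ℝ => (μ + θ * y, (σ ^ 2 * y).toNNReal)) (by fun_prop)

lemma isProbabilityMeasure_varianceGamma (μ θ σ : ℝ) {ν : ℝ} (hν : 0 < ν) :
    IsProbabilityMeasure (varianceGamma μ θ σ ν) := by
  have := isProbabilityMeasure_gammaMeasure (a := 1 / ν) (r := 1 / ν) (by positivity) (by positivity)
  exact isProbabilityMeasure_bind (measurable_varianceGamma_mixing μ θ σ).aemeasurable
    (ae_of_all _ fun _ => inferInstance)

/-- The lower quantile function `u ↦ inf {x | u ≤ F x}` of a real probability law with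
cumulative distribution function `F`; for `0 < u < 1` the set is nonempty and bounded below. -/
def quantile (P : Measure ℝ) (u : ℝ) : ℝ :=
  sInf {x : ℝ | u ≤ cdf P x}

/-- The exponential rate `c = √(2/ν + θ²) + θ` of the lower tail. -/
def vgRate (θ ν : ℝ) : ℝ :=
  √(2 / ν + θ ^ 2) + θ

/-- The leading constant `a` of the lower tail. -/
def vgCoeff (θ ν : ℝ) : ℝ :=
  1 / (ν ^ (1 / ν) * Real.Gamma (1 / ν) * (2 / ν + θ ^ 2) ^ (1 / (2 * ν)) * vgRate θ ν)

/-- The closed-form approximation `y(u)` to the lower quantile, with `c = vgRate θ ν` and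
`a = vgCoeff θ ν`. For `ν = 1` both powers with exponent `1/ν - 1 = 0` are equal to `1`, and
`y(u) = log (u / a) / c`. -/
def vgApprox (θ ν u : ℝ) : ℝ :=
  1 / vgRate θ ν *
    Real.log (u / vgCoeff θ ν *
      (vgRate θ ν /
        |Real.log (u * (vgRate θ ν / |1 / ν - 1|) ^ (1 / ν - 1))|) ^ (1 / ν - 1))

end

/-!
The skew Variance-Gamma law is the law of `W - Y` for independent gamma variables `W`, `Y` of shape
`α = 1/ν` and rates `r = √(2/ν + θ²) - θ` and `c = √(2/ν + θ²) + θ`: the Laplace transform of the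
normal mixture is `(1 - ν (θ t + t²/2)) ^ (-α)`, and the quadratic factors as
`(1 - t/r) (1 + t/c)` (`varianceGamma_eq_gammaDiff`). Equality of Laplace transforms near `0`
suffices, because they continue analytically to a vertical strip that contains the imaginary axis
(`ext_of_lintegral_exp_eq`).

For a difference of gamma variables the lower tail is explicit. Writing `Y = t + W + V` on the event
`W - Y ≤ -t`, the joint density of `(W, V)` is `a t ^ (α - 1) e ^ (-c t)` times the density of a pair
of independent gamma variables times `(1 + (W + V) / t) ^ (α - 1)` (`gammaDiff_Iic_neg`). The
expectation of the last factor is `1 + O(1/t)`, since the pair has exponential moments; this is the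
gamma-type tail (`exists_abs_gammaDiff_div_tail_sub_one_le`).

The normal mixture is equivalent to Lebesgue measure, so the cdf is continuous and strictly
increasing, and the quantile function is its inverse (`quantile_eq_iff`). With `t = -h(u)` and
`L = |log u|`, the logarithm of the tail formula reads `c t = L + log a + (α - 1) log t + O(1/t)`.
Hence `t ∼ L / c`, and substituting this into the logarithm gives the expansion of `h` with error
`O(log L / L)` (`isBigO_log_div_of_isBigO_log_equation`). The closed form `y(u)` has the same
expansion up to `O(1 / L)` (`vgApprox_sub_expansion_isBigO`) and is of exact order `L`, so the
relative error of `y` is `O(log L / L²)`.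
-/

/-! ### Laws determined by their Laplace transform near zero -/

/-- A law with an exponential moment on both sides of `0` is determined by its Laplace transform
near `0`. -/
lemma ext_of_lintegral_exp_eq {P Q : Measure ℝ} [IsProbabilityMeasure P] [IsProbabilityMeasure Q]
    {δ : ℝ} (hδ : 0 < δ)
    (hfin : ∀ t, |t| < δ → ∫⁻ x, ENNReal.ofReal (Real.exp (t * x)) ∂P ≠ ⊤)
    (heq : ∀ t, |t| < δ → ∫⁻ x, ENNReal.ofReal (Real.exp (t * x)) ∂P
      = ∫⁻ x, ENNReal.ofReal (Real.exp (t * x)) ∂Q) : P = Q := by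
  have hint : ∀ {M : Measure ℝ} {t : ℝ}, ∫⁻ x, ENNReal.ofReal (Real.exp (t * x)) ∂M ≠ ⊤ →
      t ∈ integrableExpSet id M := by
    intro M t h
    refine ⟨by fun_prop, ?_⟩
    rw [hasFiniteIntegral_iff_ofReal (ae_of_all _ fun x => (Real.exp_pos _).le)]
    exact h.lt_top
  have hsub : ∀ {M : Measure ℝ},
      (∀ t, |t| < δ → ∫⁻ x, ENNReal.ofReal (Real.exp (t * x)) ∂M ≠ ⊤) →
      Metric.ball 0 δ ⊆ interior (integrableExpSet id M) := by
    intro M h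
    refine interior_maximal (fun t ht => hint (h t ?_)) Metric.isOpen_ball
    simpa using ht
  have hP := hsub hfin
  have hQ := hsub (M := Q) (fun t ht => heq t ht ▸ hfin t ht)
  set S : Set ℂ := {z | z.re ∈ Metric.ball (0 : ℝ) δ}
  have hmgf : ∀ t : ℝ, |t| < δ → complexMGF id P t = complexMGF id Q t := by
    intro t ht
    rw [complexMGF_ofReal, complexMGF_ofReal, mgf, mgf,
      integral_eq_lintegral_of_nonneg_ae (ae_of_all _ fun x => (Real.exp_pos _).le) (by fun_prop),
      integral_eq_lintegral_of_nonneg_ae (ae_of_all _ fun x => (Real.exp_pos _).le) (by fun_prop)]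
    simp only [id_eq, heq t ht]
  have hS : Set.EqOn (complexMGF id P) (complexMGF id Q) S := by
    refine AnalyticOnNhd.eqOn_of_preconnected_of_frequently_eq (z₀ := ((0 : ℝ) : ℂ))
      (analyticOnNhd_complexMGF.mono fun z hz => hP hz)
      (analyticOnNhd_complexMGF.mono fun z hz => hQ hz)
      ((convex_ball (0 : ℝ) δ).linear_preimage Complex.reLm).isPreconnected (by simp [S, hδ]) ?_
    have hreal : ∃ᶠ x : ℝ in 𝓝[≠] 0, complexMGF id P x = complexMGF id Q x := by
      refine Eventually.frequently (eventually_nhdsWithin_of_eventually_nhds ?_)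
      filter_upwards [Metric.ball_mem_nhds (0 : ℝ) hδ] with x hx
      exact hmgf x (by simpa using hx)
    refine Tendsto.frequently (f := ((↑) : ℝ → ℂ)) ?_ hreal
    refine tendsto_nhdsWithin_iff.2 ⟨?_, ?_⟩
    · exact Complex.continuous_ofReal.continuousAt.tendsto.mono_left nhdsWithin_le_nhds
    · filter_upwards [self_mem_nhdsWithin] with x hx
      simpa using hx
  refine Measure.ext_of_charFun (funext fun t => ?_)
  rw [← complexMGF_id_mul_I, ← complexMGF_id_mul_I]
  exact hS (by simp [S, hδ])

/-! ### Gamma and Gaussian Laplace transforms -/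

/-- Exponential tilting of a gamma density is a gamma density with a shifted rate. -/
lemma ofReal_exp_mul_gammaPDF {a r s : ℝ} (hr : 0 < r) (hs : s < r) (x : ℝ) :
    ENNReal.ofReal (Real.exp (s * x)) * gammaPDF a r x
      = ENNReal.ofReal ((r / (r - s)) ^ a) * gammaPDF a (r - s) x := by
  have hrs : 0 < r - s := by linarith
  rcases lt_or_ge x 0 with hx | hx
  · simp [gammaPDF_of_neg hx]
  rw [gammaPDF_of_nonneg hx, gammaPDF_of_nonneg hx, ← ENNReal.ofReal_mul (by positivity),
    ← ENNReal.ofReal_mul (by positivity), Real.div_rpow hr.le hrs.le]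
  congr 1
  have h1 : Real.exp (-((r - s) * x)) = Real.exp (s * x) * Real.exp (-(r * x)) := by
    rw [← Real.exp_add]; ring_nf
  have h2 : (r - s) ^ a ≠ 0 := (Real.rpow_pos_of_pos hrs a).ne'
  rw [h1]
  field_simp

lemma measurable_gammaPDF (a r : ℝ) : Measurable (gammaPDF a r) :=
  (measurable_gammaPDFReal a r).ennreal_ofReal

lemma lintegral_gammaMeasure (a r : ℝ) {f : ℝ → ENNReal} (hf : Measurable f) :
    ∫⁻ x, f x ∂(gammaMeasure a r) = ∫⁻ x, gammaPDF a r x * f x := by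
  rw [gammaMeasure, lintegral_withDensity_eq_lintegral_mul _ (measurable_gammaPDF a r) hf]
  rfl

lemma lintegral_exp_mul_gammaMeasure {a r s : ℝ} (ha : 0 < a) (hr : 0 < r) (hs : s < r) :
    ∫⁻ x, ENNReal.ofReal (Real.exp (s * x)) ∂(gammaMeasure a r)
      = ENNReal.ofReal ((r / (r - s)) ^ a) := by
  rw [lintegral_gammaMeasure _ _ (by fun_prop)]
  simp_rw [mul_comm (gammaPDF a r _), ofReal_exp_mul_gammaPDF hr hs]
  rw [lintegral_const_mul _ (measurable_gammaPDF _ _), lintegral_gammaPDF_eq_one ha (by linarith),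
    mul_one]

lemma ae_pos_gammaMeasure (a r : ℝ) : ∀ᵐ x ∂(gammaMeasure a r), 0 < x := by
  rw [gammaMeasure, ae_withDensity_iff (measurable_gammaPDF a r)]
  filter_upwards [volume.ae_ne (0 : ℝ)] with x hx0 hx
  by_contra h
  exact hx (gammaPDF_of_neg (lt_of_le_of_ne (not_lt.1 h) hx0))

lemma lintegral_exp_mul_gaussianReal (m : ℝ) (v : NNReal) (t : ℝ) :
    ∫⁻ x, ENNReal.ofReal (Real.exp (t * x)) ∂(gaussianReal m v)
      = ENNReal.ofReal (Real.exp (m * t + v * t ^ 2 / 2)) := by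
  rw [← mgf_gaussianReal (p := gaussianReal m v) (X := id) (by simp), mgf]
  simp only [id_eq]
  rw [ofReal_integral_eq_lintegral_ofReal (integrable_exp_mul_gaussianReal t)
      (ae_of_all _ fun x => (Real.exp_pos _).le)]

/-! ### The Variance-Gamma law as a difference of gamma variables -/

/-- The conjugate rate `√(2/ν + θ²) - θ`, the exponential rate of the upper tail. -/
noncomputable def vgUpperRate (θ ν : ℝ) : ℝ :=
  √(2 / ν + θ ^ 2) - θ

lemma abs_lt_sqrt_two_div_add_sq (θ : ℝ) {ν : ℝ} (hν : 0 < ν) : |θ| < √(2 / ν + θ ^ 2) := by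
  rw [← Real.sqrt_sq_eq_abs]
  exact Real.sqrt_lt_sqrt (sq_nonneg _) (by linarith [div_pos two_pos hν])

lemma vgRate_pos (θ : ℝ) {ν : ℝ} (hν : 0 < ν) : 0 < vgRate θ ν := by
  have := abs_lt_sqrt_two_div_add_sq θ hν
  unfold vgRate
  linarith [neg_abs_le θ]

lemma vgUpperRate_pos (θ : ℝ) {ν : ℝ} (hν : 0 < ν) : 0 < vgUpperRate θ ν := by
  have := abs_lt_sqrt_two_div_add_sq θ hν
  unfold vgUpperRate
  linarith [le_abs_self θ]

lemma vgUpperRate_mul_vgRate (θ : ℝ) {ν : ℝ} (hν : 0 < ν) : vgUpperRate θ ν * vgRate θ ν = 2 / ν := by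
  have := Real.sq_sqrt (show 0 ≤ 2 / ν + θ ^ 2 by positivity)
  unfold vgRate vgUpperRate
  linear_combination this

/-- The law of the difference of two independent gamma variables with common shape `a` and
rates `r`, `c`. -/
noncomputable def gammaDiff (a r c : ℝ) : Measure ℝ :=
  ((gammaMeasure a r).prod (gammaMeasure a c)).map (fun p => p.1 - p.2)

/-- Both sides have Laplace transform `t ↦ (1 - ν θ t - ν t² / 2) ^ (-1/ν)`, and the quadratic
factors as `(1 - t / r) (1 + t / c)` with `r = vgUpperRate θ ν`, `c = vgRate θ ν`. -/
lemma varianceGamma_eq_gammaDiff (θ : ℝ) {ν : ℝ} (hν : 0 < ν) :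
    varianceGamma 0 θ 1 ν = gammaDiff (1 / ν) (vgUpperRate θ ν) (vgRate θ ν) := by
  have hc := vgRate_pos θ hν
  have hr := vgUpperRate_pos θ hν
  have hrc := vgUpperRate_mul_vgRate θ hν
  have hα : 0 < 1 / ν := by positivity
  have hdiff : vgUpperRate θ ν - vgRate θ ν = -2 * θ := by unfold vgRate vgUpperRate; ring
  set c := vgRate θ ν
  set r := vgUpperRate θ ν
  have := isProbabilityMeasure_varianceGamma 0 θ 1 hν
  have := isProbabilityMeasure_gammaMeasure hα hr
  have := isProbabilityMeasure_gammaMeasure hα hc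
  have : IsProbabilityMeasure (gammaDiff (1 / ν) r c) :=
    Measure.isProbabilityMeasure_map (by fun_prop)
  have hL : ∀ t : ℝ, |t| < min r c →
      ∫⁻ x, ENNReal.ofReal (Real.exp (t * x)) ∂(varianceGamma 0 θ 1 ν)
        = ENNReal.ofReal ((1 / ν / (1 / ν - (θ * t + t ^ 2 / 2))) ^ (1 / ν)) := by
    intro t ht
    obtain ⟨h1, h2⟩ := lt_min_iff.1 ht
    have hpos : 0 < (r - t) * (c + t) :=
      mul_pos (by linarith [le_abs_self t]) (by linarith [neg_abs_le t])
    rw [varianceGamma, Measure.lintegral_bind (measurable_varianceGamma_mixing 0 θ 1).aemeasurable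
      (by fun_prop)]
    rw [← lintegral_exp_mul_gammaMeasure hα hα (s := θ * t + t ^ 2 / 2) ?_]
    · refine lintegral_congr_ae ?_
      filter_upwards [ae_pos_gammaMeasure (1 / ν) (1 / ν)] with y hy
      rw [lintegral_exp_mul_gaussianReal, Real.coe_toNNReal _ (by positivity)]
      ring_nf
    · have : (r - t) * (c + t) = 2 * (1 / ν - (θ * t + t ^ 2 / 2)) := by
        linear_combination hrc + t * hdiff
      linarith
  have hR : ∀ t : ℝ, |t| < min r c →
      ∫⁻ x, ENNReal.ofReal (Real.exp (t * x)) ∂(gammaDiff (1 / ν) r c)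
        = ENNReal.ofReal ((1 / ν / (1 / ν - (θ * t + t ^ 2 / 2))) ^ (1 / ν)) := by
    intro t ht
    obtain ⟨h1, h2⟩ := lt_min_iff.1 ht
    have h3 : 0 < r - t := by linarith [le_abs_self t]
    have h4 : 0 < c - -t := by linarith [neg_abs_le t]
    rw [gammaDiff, lintegral_map (by fun_prop) (by fun_prop)]
    have hsplit : ∀ p : ℝ × ℝ, ENNReal.ofReal (Real.exp (t * (p.1 - p.2)))
        = ENNReal.ofReal (Real.exp (t * p.1)) * ENNReal.ofReal (Real.exp (-t * p.2)) := by
      intro p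
      rw [← ENNReal.ofReal_mul (Real.exp_pos _).le, ← Real.exp_add]
      ring_nf
    simp_rw [hsplit]
    rw [lintegral_prod_mul (f := fun x => ENNReal.ofReal (Real.exp (t * x)))
        (g := fun y => ENNReal.ofReal (Real.exp (-t * y))) (by fun_prop) (by fun_prop),
      lintegral_exp_mul_gammaMeasure hα hr (by linarith),
      lintegral_exp_mul_gammaMeasure hα hc (by linarith), ← ENNReal.ofReal_mul (by positivity),
      ← Real.mul_rpow (by positivity) (by positivity)]
    have : (r - t) * (c - -t) = 2 * (1 / ν - (θ * t + t ^ 2 / 2)) := by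
      linear_combination hrc + t * hdiff
    rw [div_mul_div_comm, hrc, this, show 2 / ν = 2 * (1 / ν) by ring,
      mul_div_mul_left _ _ two_ne_zero]
  exact ext_of_lintegral_exp_eq (lt_min hr hc) (fun t ht => hL t ht ▸ ENNReal.ofReal_ne_top)
    (fun t ht => (hL t ht).trans (hR t ht).symm)

/-! ### The lower tail of a difference of gamma variables -/

lemma gammaMeasure_Ici (a c s : ℝ) :
    gammaMeasure a c (Set.Ici s) = ∫⁻ v, (Set.Ici 0).indicator (fun v => gammaPDF a c (s + v)) v := by
  rw [gammaMeasure, withDensity_apply _ measurableSet_Ici, ← lintegral_indicator measurableSet_Ici,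
    ← lintegral_add_left_eq_self _ s]
  congr 1 with v
  simp [Set.indicator_apply]

/-- The leading term `K t ^ (a - 1) e ^ (-c t)` of the lower tail of `gammaDiff a r c`, with
`K = (r c / (r + c)) ^ a / (Γ(a) c)`. -/
noncomputable def gammaDiffTail (a r c t : ℝ) : ℝ :=
  (r * c / (r + c)) ^ a / (Real.Gamma a * c) * t ^ (a - 1) * Real.exp (-c * t)

/-- The joint density of `(w, t + w + v)` is the leading tail term times a product gamma density
times the correction `(1 + (w + v) / t) ^ (a - 1)`. -/
lemma gammaPDF_mul_gammaPDF_add {a r c t : ℝ} (ha : 0 < a) (hr : 0 < r) (hc : 0 < c) (ht : 0 < t)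
    (w v : ℝ) :
    gammaPDF a r w * (Set.Ici 0).indicator (fun v => gammaPDF a c (t + w + v)) v
      = ENNReal.ofReal (gammaDiffTail a r c t) * (gammaPDF a (r + c) w *
        (gammaPDF 1 c v * ENNReal.ofReal ((1 + (w + v) / t) ^ (a - 1)))) := by
  rcases lt_or_ge w 0 with hw | hw
  · simp [gammaPDF_of_neg hw]
  rcases lt_or_ge v 0 with hv | hv
  · simp [gammaPDF_of_neg hv, hv]
  have hΓ := Real.Gamma_pos_of_pos ha
  have hbase : 0 < 1 + (w + v) / t := by positivity
  have htail : 0 ≤ gammaDiffTail a r c t := by unfold gammaDiffTail; positivity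
  rw [Set.indicator_of_mem (show v ∈ Set.Ici 0 from hv), gammaPDF_of_nonneg hw,
    gammaPDF_of_nonneg hw, gammaPDF_of_nonneg hv,
    gammaPDF_of_nonneg (show 0 ≤ t + w + v by positivity), ← ENNReal.ofReal_mul (by positivity),
    ← ENNReal.ofReal_mul (by positivity), ← ENNReal.ofReal_mul (by positivity),
    ← ENNReal.ofReal_mul htail]
  congr 1
  have hsum : t + w + v = t * (1 + (w + v) / t) := by field_simp; ring
  have hexp : Real.exp (-c * t) * Real.exp (-((r + c) * w)) * Real.exp (-(c * v))
      = Real.exp (-(r * w)) * Real.exp (-(c * (t + w + v))) := by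
    simp only [← Real.exp_add]; ring_nf
  have hpow : (t + w + v) ^ (a - 1) = t ^ (a - 1) * (1 + (w + v) / t) ^ (a - 1) := by
    rw [hsum, Real.mul_rpow ht.le hbase.le]
  have hrc : (r + c) ^ a ≠ 0 := by positivity
  rw [hpow, gammaDiffTail, Real.div_rpow (by positivity) (by positivity),
    Real.mul_rpow hr.le hc.le]
  simp only [Real.rpow_one, Real.Gamma_one, div_one, sub_self, Real.rpow_zero, mul_one]
  calc _ = r ^ a * c ^ a / (Real.Gamma a) ^ 2 * w ^ (a - 1) * t ^ (a - 1) *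
        (1 + (w + v) / t) ^ (a - 1) *
          (Real.exp (-(r * w)) * Real.exp (-(c * (t + w + v)))) := by
        field_simp
    _ = _ := by
        rw [← hexp]
        field_simp

/-- The lower tail of a difference of gamma variables, exactly: the leading term times an
expectation over a product of two gamma laws. -/
lemma gammaDiff_Iic_neg {a r c t : ℝ} (ha : 0 < a) (hr : 0 < r) (hc : 0 < c) (ht : 0 < t) :
    gammaDiff a r c (Set.Iic (-t)) = ENNReal.ofReal (gammaDiffTail a r c t) *
      ∫⁻ p, ENNReal.ofReal ((1 + (p.1 + p.2) / t) ^ (a - 1))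
        ∂((gammaMeasure a (r + c)).prod (gammaMeasure 1 c)) := by
  have := isProbabilityMeasure_gammaMeasure ha hc
  have := isProbabilityMeasure_gammaMeasure one_pos hc
  have hsec : ∀ w : ℝ, Prod.mk w ⁻¹' ((fun p : ℝ × ℝ => p.1 - p.2) ⁻¹' Set.Iic (-t))
      = Set.Ici (t + w) := by
    intro w
    ext y
    simp only [Set.mem_preimage, Set.mem_Iic, Set.mem_Ici]
    constructor <;> intro h <;> linarith
  have hmeas : MeasurableSet ((fun p : ℝ × ℝ => p.1 - p.2) ⁻¹' Set.Iic (-t)) :=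
    measurableSet_Iic.preimage (by fun_prop)
  have hmeas' := measurable_measure_prodMk_left (ν := gammaMeasure a c) hmeas
  have hg := measurable_gammaPDF
  rw [gammaDiff, Measure.map_apply (by fun_prop) measurableSet_Iic, Measure.prod_apply hmeas,
    lintegral_gammaMeasure _ _ hmeas', lintegral_prod _ (by fun_prop),
    lintegral_gammaMeasure _ _ (by fun_prop), ← lintegral_const_mul' _ _ ENNReal.ofReal_ne_top]
  refine lintegral_congr fun w => ?_
  rw [hsec, gammaMeasure_Ici, lintegral_gammaMeasure _ _ (by fun_prop),
    ← lintegral_const_mul _ ((by fun_prop : Measurable fun v => gammaPDF a c (t + w + v)).indicator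
      measurableSet_Ici),
    ← lintegral_const_mul _ (by fun_prop), ← lintegral_const_mul _ (by fun_prop)]
  exact lintegral_congr fun v => gammaPDF_mul_gammaPDF_add ha hr hc ht w v

lemma abs_exp_sub_one_le_mul_exp (y : ℝ) : |Real.exp y - 1| ≤ |y| * Real.exp |y| := by
  have h1 := Real.add_one_le_exp y
  have h2 := Real.add_one_le_exp (-y)
  have h3 : Real.exp y * Real.exp (-y) = 1 := by rw [← Real.exp_add]; simp
  have h4 := Real.exp_pos y
  rcases le_total 0 y with h | h
  · rw [abs_of_nonneg h, abs_of_nonneg (by linarith)]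
    nlinarith
  · rw [abs_of_nonpos h, abs_of_nonpos (by have := Real.exp_le_one_iff.2 h; linarith)]
    nlinarith [Real.one_le_exp (neg_nonneg.2 h)]

/-- The correction factor is `1 + O(1 / t)` with an exponentially growing constant; for `t` large
the growth rate is at most half of `c`, so that it is integrable against both gamma laws. -/
lemma abs_one_add_div_rpow_sub_one_le {p c t x : ℝ} (hc : 0 < c) (ht : 0 < t)
    (htc : |p| ≤ c / 4 * t) (hx : 0 ≤ x) :
    |(1 + x / t) ^ p - 1| ≤ |p| * (4 / c) / t * Real.exp (c / 2 * x) := by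
  have hs : 0 ≤ x / t := by positivity
  have hpos : 0 < 1 + x / t := by positivity
  have hlog0 : 0 ≤ Real.log (1 + x / t) := Real.log_nonneg (by linarith)
  have hlog : Real.log (1 + x / t) ≤ x / t := by
    linarith [Real.log_le_sub_one_of_pos hpos]
  have hy : |Real.log (1 + x / t) * p| ≤ |p| * (x / t) := by
    rw [abs_mul, abs_of_nonneg hlog0, mul_comm]
    gcongr
  have hy' : |p| * (x / t) ≤ c / 4 * x := by
    rw [mul_div_assoc', div_le_iff₀ ht]
    nlinarith
  have hxe : x ≤ 4 / c * Real.exp (c / 4 * x) := by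
    have := Real.add_one_le_exp (c / 4 * x)
    calc x = 4 / c * (c / 4 * x) := by field_simp
      _ ≤ _ := by gcongr; linarith
  rw [Real.rpow_def_of_pos hpos]
  calc _ ≤ |Real.log (1 + x / t) * p| * Real.exp |Real.log (1 + x / t) * p| :=
        abs_exp_sub_one_le_mul_exp _
    _ ≤ |p| * (x / t) * Real.exp (c / 4 * x) := by
        gcongr
        exact hy.trans hy'
    _ ≤ |p| * (4 / c * Real.exp (c / 4 * x) / t) * Real.exp (c / 4 * x) := by gcongr
    _ = |p| * (4 / c) / t * (Real.exp (c / 4 * x) * Real.exp (c / 4 * x)) := by ring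
    _ = _ := by rw [← Real.exp_add]; ring_nf

lemma integrable_exp_mul_gammaMeasure {a r s : ℝ} (ha : 0 < a) (hr : 0 < r) (hs : s < r) :
    Integrable (fun x => Real.exp (s * x)) (gammaMeasure a r) := by
  refine ⟨by fun_prop, ?_⟩
  rw [hasFiniteIntegral_iff_ofReal (ae_of_all _ fun x => (Real.exp_pos _).le),
    lintegral_exp_mul_gammaMeasure ha hr hs]
  exact ENNReal.ofReal_lt_top

/-- The difference of two gamma variables has a gamma-type lower tail. -/
lemma exists_abs_gammaDiff_div_tail_sub_one_le {a r c : ℝ} (ha : 0 < a) (hr : 0 < r) (hc : 0 < c) :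
    ∃ C : ℝ, ∀ᶠ t : ℝ in atTop,
      |(gammaDiff a r c).real (Set.Iic (-t)) / gammaDiffTail a r c t - 1| ≤ C / t := by
  have := isProbabilityMeasure_gammaMeasure ha (add_pos hr hc)
  have := isProbabilityMeasure_gammaMeasure one_pos hc
  set m := (gammaMeasure a (r + c)).prod (gammaMeasure 1 c)
  have hE : Integrable (fun p : ℝ × ℝ => Real.exp (c / 2 * p.1) * Real.exp (c / 2 * p.2)) m :=
    (integrable_exp_mul_gammaMeasure ha (add_pos hr hc) (by linarith)).mul_prod
      (integrable_exp_mul_gammaMeasure one_pos hc (by linarith))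
  refine ⟨|a - 1| * (4 / c) * ∫ p, Real.exp (c / 2 * p.1) * Real.exp (c / 2 * p.2) ∂m, ?_⟩
  filter_upwards [eventually_gt_atTop 0, eventually_ge_atTop (4 / c * |a - 1|)] with t ht ht2
  have htc : |a - 1| ≤ c / 4 * t := by
    calc |a - 1| = c / 4 * (4 / c * |a - 1|) := by field_simp
      _ ≤ _ := by gcongr
  have htail : 0 < gammaDiffTail a r c t := by
    have := Real.Gamma_pos_of_pos ha
    unfold gammaDiffTail; positivity
  have hposm : ∀ᵐ p ∂m, 0 < p.1 ∧ 0 < p.2 := by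
    refine (Measure.quasiMeasurePreserving_fst.ae (ae_pos_gammaMeasure _ _)).and
      (Measure.quasiMeasurePreserving_snd.ae (ae_pos_gammaMeasure _ _))
  set f : ℝ × ℝ → ℝ := fun p => (1 + (p.1 + p.2) / t) ^ (a - 1)
  have hfm : Measurable f := by fun_prop
  have hf0 : 0 ≤ᵐ[m] f := by
    filter_upwards [hposm] with p hp
    have := hp.1; have := hp.2
    exact Real.rpow_nonneg (by positivity) _
  have hbound : ∀ᵐ p ∂m, ‖f p - 1‖ ≤ |a - 1| * (4 / c) / t *
      (Real.exp (c / 2 * p.1) * Real.exp (c / 2 * p.2)) := by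
    filter_upwards [hposm] with p hp
    rw [← Real.exp_add, ← mul_add]
    exact abs_one_add_div_rpow_sub_one_le hc ht htc (by linarith [hp.1, hp.2])
  have hf1 : Integrable (fun p => f p - 1) m :=
    (hE.const_mul _).mono' (by fun_prop) hbound
  have hf : Integrable f m :=
    (hf1.add (integrable_const (1 : ℝ))).congr (ae_of_all _ fun p => by simp)
  have hval : (gammaDiff a r c).real (Set.Iic (-t)) / gammaDiffTail a r c t - 1
      = ∫ p, (f p - 1) ∂m := by
    rw [integral_sub hf (integrable_const _), integral_eq_lintegral_of_nonneg_ae hf0 (by fun_prop),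
      measureReal_def, gammaDiff_Iic_neg ha hr hc ht, ENNReal.toReal_mul,
      ENNReal.toReal_ofReal htail.le, mul_div_cancel_left₀ _ htail.ne']
    simp [f, m]
  rw [hval]
  refine (norm_integral_le_of_norm_le (hE.const_mul _) hbound).trans_eq ?_
  rw [integral_const_mul]
  ring

lemma gammaDiffTail_varianceGamma (θ : ℝ) {ν : ℝ} (hν : 0 < ν) (t : ℝ) :
    gammaDiffTail (1 / ν) (vgUpperRate θ ν) (vgRate θ ν) t
      = vgCoeff θ ν * t ^ (1 / ν - 1) * Real.exp (-(vgRate θ ν) * t) := by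
  have hb : 0 < 2 / ν + θ ^ 2 := by positivity
  have hsum : vgUpperRate θ ν + vgRate θ ν = 2 * √(2 / ν + θ ^ 2) := by
    unfold vgUpperRate vgRate; ring
  have hpow : (2 / ν + θ ^ 2) ^ (1 / (2 * ν)) = √(2 / ν + θ ^ 2) ^ (1 / ν) := by
    rw [Real.sqrt_eq_rpow, ← Real.rpow_mul hb.le]
    congr 1; field_simp
  have hs : 0 < √(2 / ν + θ ^ 2) := Real.sqrt_pos.2 hb
  rw [gammaDiffTail, vgCoeff, vgUpperRate_mul_vgRate θ hν, hsum, hpow,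
    show 2 / ν / (2 * √(2 / ν + θ ^ 2)) = 1 / (ν * √(2 / ν + θ ^ 2)) by field_simp,
    Real.div_rpow one_pos.le (by positivity), Real.one_rpow, Real.mul_rpow hν.le hs.le, div_div]
  congr 3
  ring

/-! ### The distribution function and its inverse -/

lemma varianceGamma_apply (θ ν : ℝ) {s : Set ℝ} (hs : MeasurableSet s) :
    varianceGamma 0 θ 1 ν s = ∫⁻ y, gaussianReal (0 + θ * y) (1 ^ 2 * y).toNNReal s
      ∂(gammaMeasure (1 / ν) (1 / ν)) :=
  Measure.bind_apply hs (measurable_varianceGamma_mixing 0 θ 1).aemeasurable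

lemma toNNReal_one_sq_mul_ne_zero {y : ℝ} (hy : 0 < y) : ((1 : ℝ) ^ 2 * y).toNNReal ≠ 0 := by
  simpa using hy

lemma varianceGamma_absolutelyContinuous (θ ν : ℝ) : varianceGamma 0 θ 1 ν ≪ volume := by
  refine Measure.AbsolutelyContinuous.mk fun s hs h0 => ?_
  rw [varianceGamma_apply θ ν hs]
  refine (lintegral_congr_ae ?_).trans lintegral_zero
  filter_upwards [ae_pos_gammaMeasure (1 / ν) (1 / ν)] with y hy
  exact gaussianReal_absolutelyContinuous _ (toNNReal_one_sq_mul_ne_zero hy) h0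

lemma absolutelyContinuous_varianceGamma (θ : ℝ) {ν : ℝ} (hν : 0 < ν) :
    volume ≪ varianceGamma 0 θ 1 ν := by
  have := isProbabilityMeasure_gammaMeasure (a := 1 / ν) (r := 1 / ν) (by positivity)
    (by positivity)
  refine Measure.AbsolutelyContinuous.mk fun s hs h0 => ?_
  have hmeas := (Measure.measurable_coe hs).comp (measurable_varianceGamma_mixing 0 θ 1)
  rw [varianceGamma_apply θ ν hs] at h0
  obtain ⟨y, hy, hy0⟩ := (((lintegral_eq_zero_iff hmeas).1 h0).and
    (ae_pos_gammaMeasure (1 / ν) (1 / ν))).exists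
  exact gaussianReal_absolutelyContinuous' _ (toNNReal_one_sq_mul_ne_zero hy0) hy

lemma continuous_cdf_of_absolutelyContinuous {P : Measure ℝ} [IsProbabilityMeasure P]
    (hP : P ≪ volume) : Continuous (cdf P) := by
  refine continuous_iff_continuousAt.2 fun x => ?_
  rw [(monotone_cdf P).continuousAt_iff_leftLim_eq_rightLim, StieltjesFunction.rightLim_eq]
  have h0 : (cdf P).measure {x} = 0 := by
    rw [measure_cdf]
    exact hP (measure_singleton x)
  rw [StieltjesFunction.measure_singleton, ENNReal.ofReal_eq_zero] at h0
  exact le_antisymm ((monotone_cdf P).leftLim_le le_rfl) (by linarith)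

lemma strictMono_cdf_of_absolutelyContinuous {P : Measure ℝ} [IsProbabilityMeasure P]
    (hP : volume ≪ P) : StrictMono (cdf P) := by
  intro x y hxy
  by_contra h
  have h0 : P (Set.Ioc x y) = 0 := by
    rw [← measure_cdf P, StieltjesFunction.measure_Ioc, ENNReal.ofReal_eq_zero]
    linarith
  have := hP h0
  rw [Real.volume_Ioc, ENNReal.ofReal_eq_zero] at this
  linarith

/-- For a continuous strictly increasing cdf the quantile function is the inverse. -/
lemma quantile_eq_iff {P : Measure ℝ} (hc : Continuous (cdf P)) (hm : StrictMono (cdf P))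
    {u : ℝ} (h0 : 0 < u) (h1 : u < 1) (x : ℝ) : quantile P u = x ↔ cdf P x = u := by
  have key : ∀ z, cdf P z = u → quantile P u = z := by
    intro z hz
    have : {x : ℝ | u ≤ cdf P x} = Set.Ici z := by
      ext w
      rw [Set.mem_ofPred_eq, ← hz, hm.le_iff_le, Set.mem_Ici]
    rw [quantile, this, csInf_Ici]
  refine ⟨fun hx => ?_, key x⟩
  obtain ⟨z, hz⟩ := mem_range_of_exists_le_of_exists_ge hc
    ((tendsto_cdf_atBot P).eventually_le_const h0).exists
    ((tendsto_cdf_atTop P).eventually_const_le h1).exists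
  rw [← hx, key z hz, hz]

lemma tendsto_quantile_atBot {P : Measure ℝ} [IsProbabilityMeasure P] (hc : Continuous (cdf P))
    (hm : StrictMono (cdf P)) : Tendsto (quantile P) (𝓝[>] 0) atBot := by
  refine tendsto_atBot.2 fun M => ?_
  have hpos : 0 < cdf P M := (cdf_nonneg P (M - 1)).trans_lt (hm (by linarith))
  filter_upwards [Ioo_mem_nhdsGT (lt_min hpos one_pos)] with u hu
  obtain ⟨hu1, hu2⟩ := lt_min_iff.1 hu.2
  have := (quantile_eq_iff hc hm hu.1 hu2 _).1 rfl
  exact (hm.lt_iff_lt.1 (this.trans_lt hu1)).le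

/-! ### Asymptotic inversion of a gamma-type tail -/

lemma isBigO_log_of_tendsto_one {ι : Type*} {l : Filter ι} {q : ι → ℝ}
    (hq : Tendsto q l (𝓝 1)) : (fun i => Real.log (q i)) =O[l] (fun i => q i - 1) := by
  simpa [Function.comp_def] using
    (Real.hasDerivAt_log one_ne_zero).isBigO_sub.comp_tendsto hq

section Inversion

variable {ι : Type*} {l : Filter ι} {L t : ι → ℝ} {A c p : ℝ}

/-- First-order inversion: the linear term dominates the logarithm. -/
lemma tendsto_div_of_isBigO_log_equation (ht : Tendsto t l atTop)
    (h : (fun i => c * t i - (L i + A + p * Real.log (t i))) =O[l] (fun i => 1 / t i)) :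
    Tendsto (fun i => L i / t i) l (𝓝 c) := by
  have ht1 : Tendsto (fun i => 1 / t i) l (𝓝 0) := tendsto_const_nhds.div_atTop ht
  have hR := h.trans_tendsto ht1
  have hlog : Tendsto (fun i => Real.log (t i) / t i) l (𝓝 0) :=
    (Real.isLittleO_log_id_atTop.tendsto_div_nhds_zero).comp ht
  have hlim := ((tendsto_const_nhds (x := c)).sub (hlog.const_mul p)).sub
    ((hR.add_const A).mul ht1)
  simp only [mul_zero, sub_zero] at hlim
  refine hlim.congr' ?_
  filter_upwards [ht.eventually_gt_atTop 0] with i hi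
  field_simp
  ring

/-- Second-order inversion: in `c t = L + A + p log t + O(1 / t)`, the first-order equivalent
`t ∼ L / c` may be substituted into the logarithm, at the cost of an error `O(log L / L)`. -/
lemma isBigO_log_div_of_isBigO_log_equation (hL : Tendsto L l atTop) (ht : Tendsto t l atTop)
    (hc : 0 < c)
    (h : (fun i => c * t i - (L i + A + p * Real.log (t i))) =O[l] (fun i => 1 / t i)) :
    (fun i => c * t i - (L i + A + p * (Real.log (L i) - Real.log c))) =O[l]
      (fun i => Real.log (L i) / L i) := by
  have hLt := tendsto_div_of_isBigO_log_equation ht h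
  have hLpos := hL.eventually_gt_atTop 0
  have htpos := ht.eventually_gt_atTop 0
  have hlogL : Tendsto (fun i => Real.log (L i)) l atTop := Real.tendsto_log_atTop.comp hL
  have hone : (fun _ => (1 : ℝ)) =O[l] (fun i => Real.log (L i)) :=
    (isLittleO_const_left.2 (Or.inr (tendsto_abs_atTop_atTop.comp hlogL))).isBigO
  have hinv : (fun i => 1 / t i) =O[l] (fun i => 1 / L i) := by
    refine ((hLt.isBigO_one ℝ).mul (isBigO_refl (fun i => 1 / L i) l)).congr' ?_ ?_
    · filter_upwards [hLpos, htpos] with i h1 h2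
      field_simp
    · exact Eventually.of_forall fun i => one_mul _
  have hR : (fun i => c * t i - (L i + A + p * Real.log (t i))) =O[l]
      (fun i => Real.log (L i) / L i) := by
    refine (h.trans hinv).trans ?_
    simpa only [div_eq_mul_inv] using hone.mul (isBigO_refl (fun i => (L i)⁻¹) l)
  have hq : Tendsto (fun i => c * t i / L i) l (𝓝 1) := by
    have := (tendsto_const_nhds (x := c)).div hLt hc.ne'
    rw [div_self hc.ne'] at this
    exact this.congr fun i => div_div_eq_mul_div _ _ _
  have hlogq : ∀ᶠ i in l, Real.log (c * t i / L i)
      = Real.log (t i) - (Real.log (L i) - Real.log c) := by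
    filter_upwards [hLpos, htpos] with i h1 h2
    rw [Real.log_div (by positivity) h1.ne', Real.log_mul hc.ne' h2.ne']
    ring
  have hlogq0 : Tendsto (fun i => Real.log (c * t i / L i)) l (𝓝 0) := by
    simpa using hq.log one_ne_zero
  have hlogt : (fun i => Real.log (t i)) =O[l] (fun i => Real.log (L i)) := by
    have h1 := (((hlogq0.sub_const (Real.log c)).isBigO_one ℝ).trans hone).add
      (isBigO_refl (fun i => Real.log (L i)) l)
    refine h1.congr' ?_ EventuallyEq.rfl
    filter_upwards [hlogq] with i hi
    rw [hi]
    ring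
  have hdiff : (fun i => c * t i - L i) =O[l] (fun i => Real.log (L i)) := by
    have h1 := ((((h.trans_tendsto (tendsto_const_nhds.div_atTop ht)).isBigO_one ℝ).trans hone).add
      ((isBigO_const_const A one_ne_zero l).trans hone)).add (hlogt.const_mul_left p)
    refine h1.congr_left fun i => ?_
    ring
  have hqO : (fun i => c * t i / L i - 1) =O[l] (fun i => Real.log (L i) / L i) := by
    have h1 := hdiff.mul (isBigO_refl (fun i => (L i)⁻¹) l)
    refine h1.congr' ?_ EventuallyEq.rfl
    filter_upwards [hLpos] with i h1
    field_simp
  have hlogqO := (isBigO_log_of_tendsto_one hq).trans hqO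
  refine (hR.add (hlogqO.const_mul_left p)).congr' ?_ EventuallyEq.rfl
  filter_upwards [hlogq] with i hi
  rw [hi]
  ring

/-- A shift of the argument changes a logarithm by the reciprocal of the argument. -/
lemma isBigO_log_sub_const_sub_log (hL : Tendsto L l atTop) (k : ℝ) :
    (fun i => Real.log (L i - k) - Real.log (L i)) =O[l] (fun i => 1 / L i) := by
  have h1 : Tendsto (fun i => k * (1 / L i)) l (𝓝 0) := by
    simpa using (tendsto_const_nhds.div_atTop hL : Tendsto (fun i => 1 / L i) l (𝓝 0)).const_mul k
  have h2 : Tendsto (fun i => 1 - k * (1 / L i)) l (𝓝 1) := by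
    simpa using h1.const_sub 1
  have h3 : (fun i => 1 - k * (1 / L i) - 1) =O[l] (fun i => 1 / L i) :=
    ((isBigO_refl (fun i => 1 / L i) l).const_mul_left (-k)).congr_left fun i => by ring
  refine ((isBigO_log_of_tendsto_one h2).trans h3).congr' ?_ EventuallyEq.rfl
  filter_upwards [hL.eventually_gt_atTop 0, hL.eventually_gt_atTop k] with i hi hk
  rw [← Real.log_div (by linarith) hi.ne']
  congr 1
  field_simp

end Inversion

/-! ### Expansions of the quantile function -/

lemma vgCoeff_pos (θ : ℝ) {ν : ℝ} (hν : 0 < ν) : 0 < vgCoeff θ ν := by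
  have := vgRate_pos θ hν
  have := Real.Gamma_pos_of_pos (show 0 < 1 / ν by positivity)
  unfold vgCoeff
  positivity

/-- The factor inside the iterated logarithm is positive also for `ν = 1`, where it is
`0 ^ 0 = 1`. -/
lemma div_abs_rpow_pos {c : ℝ} (hc : 0 < c) (p : ℝ) : 0 < (c / |p|) ^ p := by
  rcases eq_or_ne p 0 with rfl | hp
  · simp
  · positivity

lemma vgApprox_sub_expansion_isBigO (θ : ℝ) {ν : ℝ} (hν : 0 < ν) :
    (fun u => vgApprox θ ν u - (Real.log u / vgRate θ ν
          - (1 / ν - 1) * Real.log |Real.log u| / vgRate θ ν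
          + ((1 / ν - 1) * Real.log (vgRate θ ν) - Real.log (vgCoeff θ ν)) / vgRate θ ν))
      =O[𝓝[>] (0 : ℝ)] (fun u => 1 / |Real.log u|) := by
  have hc := vgRate_pos θ hν
  have ha := vgCoeff_pos θ hν
  have hκ := div_abs_rpow_pos hc (1 / ν - 1)
  unfold vgApprox
  set c := vgRate θ ν
  set a := vgCoeff θ ν
  set p := 1 / ν - 1
  set κ := (c / |p|) ^ p
  have hL : Tendsto (fun u => |Real.log u|) (𝓝[>] 0) atTop :=
    tendsto_abs_atBot_atTop.comp Real.tendsto_log_nhdsGT_zero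
  refine ((isBigO_log_sub_const_sub_log hL (Real.log κ)).const_mul_left (-p / c)).congr' ?_
    EventuallyEq.rfl
  filter_upwards [self_mem_nhdsWithin, Real.tendsto_log_nhdsGT_zero.eventually_lt_atBot 0,
    hL.eventually_gt_atTop (Real.log κ)] with u hu hlog hk
  have hu : 0 < u := hu
  have habs : |Real.log (u * κ)| = |Real.log u| - Real.log κ := by
    rw [Real.log_mul hu.ne' hκ.ne']
    rw [abs_of_neg hlog] at hk ⊢
    rw [abs_of_neg (by linarith)]
    ring
  have hpos : 0 < |Real.log u| - Real.log κ := by linarith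
  rw [habs]
  generalize |Real.log u| - Real.log κ = D at hpos
  rw [Real.log_mul (by positivity) (by positivity), Real.log_div hu.ne' ha.ne',
    Real.log_rpow (by positivity), Real.log_div hc.ne' hpos.ne']
  field_simp
  ring

theorem mainTheorem8 (θ ν : ℝ) (hν : 0 < ν) :
    -- `h = quantile` is the inverse function of the cdf `g`
    (∀ u : ℝ, 0 < u → u < 1 → ∀ x : ℝ,
      quantile (varianceGamma 0 θ 1 ν) u = x ↔ cdf (varianceGamma 0 θ 1 ν) x = u) ∧
    -- the Gamma-type lower tail `g(x) = a |x|^(1/ν-1) e^(-c|x|) (1 + O(1/|x|))` as `x → -∞`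
    (∃ ε : ℝ → ℝ, ε =O[atBot] (fun x => 1 / |x|) ∧
      ∀ᶠ x in atBot, cdf (varianceGamma 0 θ 1 ν) x =
        vgCoeff θ ν * |x| ^ (1 / ν - 1) * Real.exp (-(vgRate θ ν) * |x|) * (1 + ε x)) ∧
    -- `h(u) = y(u) (1 + O(log|log u| / (log u)²))` as `u → 0⁺`
    (∃ ε : ℝ → ℝ,
      ε =O[𝓝[>] (0 : ℝ)] (fun u => Real.log |Real.log u| / (Real.log u) ^ 2) ∧
      ∀ᶠ u in 𝓝[>] (0 : ℝ),
        quantile (varianceGamma 0 θ 1 ν) u = vgApprox θ ν u * (1 + ε u)) ∧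
    -- the explicit expansion of `h(u)` as `u → 0⁺`
    (fun u : ℝ => quantile (varianceGamma 0 θ 1 ν) u -
        (Real.log u / vgRate θ ν
          - (1 / ν - 1) * Real.log |Real.log u| / vgRate θ ν
          + ((1 / ν - 1) * Real.log (vgRate θ ν) - Real.log (vgCoeff θ ν)) / vgRate θ ν))
      =O[𝓝[>] (0 : ℝ)] (fun u => Real.log |Real.log u| / |Real.log u|) := by
  have := isProbabilityMeasure_varianceGamma 0 θ 1 hν
  have hcont := continuous_cdf_of_absolutelyContinuous (varianceGamma_absolutelyContinuous θ ν)
  have hmono := strictMono_cdf_of_absolutelyContinuous (absolutelyContinuous_varianceGamma θ hν)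
  have hinv : ∀ u : ℝ, 0 < u → u < 1 → ∀ x : ℝ,
      quantile (varianceGamma 0 θ 1 ν) u = x ↔ cdf (varianceGamma 0 θ 1 ν) x = u :=
    fun u h0 h1 x => quantile_eq_iff hcont hmono h0 h1 x
  have hq := tendsto_quantile_atBot hcont hmono
  have hc := vgRate_pos θ hν
  have ha := vgCoeff_pos θ hν
  have happrox := vgApprox_sub_expansion_isBigO θ hν
  obtain ⟨C, hC⟩ := exists_abs_gammaDiff_div_tail_sub_one_le (show 0 < 1 / ν by positivity)
    (vgUpperRate_pos θ hν) hc
  simp only [gammaDiffTail_varianceGamma θ hν, ← varianceGamma_eq_gammaDiff θ hν,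
    ← cdf_eq_real] at hC
  set P := varianceGamma 0 θ 1 ν
  set c := vgRate θ ν
  set a := vgCoeff θ ν
  set p := 1 / ν - 1
  set K : ℝ → ℝ := fun t => a * t ^ p * Real.exp (-c * t) with hK
  have hKpos : ∀ t, 0 < t → 0 < K t := fun t ht => by simp only [hK]; positivity
  have htail : (fun t => cdf P (-t) / K t - 1) =O[atTop] (fun t : ℝ => 1 / t) := by
    refine IsBigO.of_bound |C| ?_
    filter_upwards [hC, eventually_gt_atTop 0] with t ht h0
    rw [Real.norm_eq_abs, Real.norm_of_nonneg (by positivity), mul_one_div]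
    exact ht.trans (by gcongr; exact le_abs_self C)
  have hL : Tendsto (fun u => |Real.log u|) (𝓝[>] 0) atTop :=
    tendsto_abs_atBot_atTop.comp Real.tendsto_log_nhdsGT_zero
  have hneg := Real.tendsto_log_nhdsGT_zero.eventually_lt_atBot 0
  have ht : Tendsto (fun u => -quantile P u) (𝓝[>] 0) atTop := tendsto_neg_atBot_atTop.comp hq
  -- Taking logarithms in `u = K (t) (1 + O(1 / t))`, `t = -h (u)`.
  have heq : (fun u => c * (-quantile P u)
      - (|Real.log u| + Real.log a + p * Real.log (-quantile P u))) =O[𝓝[>] 0]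
        (fun u => 1 / (-quantile P u)) := by
    have h1 := htail.comp_tendsto ht
    have h2 : Tendsto (fun u => cdf P (- -quantile P u) / K (-quantile P u)) (𝓝[>] 0) (𝓝 1) := by
      have := (h1.trans_tendsto (tendsto_const_nhds.div_atTop ht)).add_const 1
      simpa [Function.comp_def] using this
    refine ((isBigO_log_of_tendsto_one h2).trans h1).congr' ?_ EventuallyEq.rfl
    filter_upwards [ht.eventually_gt_atTop 0, hneg, Ioo_mem_nhdsGT one_pos] with u htu hlog hu
    rw [neg_neg, (hinv u hu.1 hu.2 _).1 rfl, Real.log_div hu.1.ne' (hKpos _ htu).ne',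
      abs_of_neg hlog]
    simp only [hK]
    rw [Real.log_mul (by positivity) (by positivity), Real.log_mul ha.ne' (by positivity),
      Real.log_rpow htu, Real.log_exp]
    ring
  have hexp : (fun u : ℝ => quantile P u - (Real.log u / c - p * Real.log |Real.log u| / c
      + (p * Real.log c - Real.log a) / c)) =O[𝓝[>] (0 : ℝ)]
        (fun u => Real.log |Real.log u| / |Real.log u|) := by
    refine ((isBigO_log_div_of_isBigO_log_equation hL ht hc heq).const_mul_left (-1 / c)).congr' ?_
      EventuallyEq.rfl
    filter_upwards [hneg] with u hlog
    have : Real.log u = -|Real.log u| := by rw [abs_of_neg hlog]; ring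
    rw [show Real.log u / c = -|Real.log u| / c by rw [← this]]
    field_simp
    ring
  refine ⟨hinv, ?_, ?_, hexp⟩
  · refine ⟨fun x => cdf P x / K |x| - 1, ?_, ?_⟩
    · refine (htail.comp_tendsto tendsto_abs_atBot_atTop).congr' ?_ EventuallyEq.rfl
      filter_upwards [eventually_lt_atBot 0] with x hx
      simp only [Function.comp, abs_of_neg hx, neg_neg]
    · filter_upwards [eventually_lt_atBot 0] with x hx
      have := hKpos |x| (abs_pos.2 hx.ne)
      change _ = K |x| * _
      field_simp
      ring
  · have hloglog : Tendsto (fun u => Real.log |Real.log u|) (𝓝[>] 0) atTop :=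
      Real.tendsto_log_atTop.comp hL
    have hone : (fun _ => (1 : ℝ)) =O[𝓝[>] (0 : ℝ)] (fun u => Real.log |Real.log u|) :=
      (isLittleO_const_left.2 (Or.inr (tendsto_abs_atTop_atTop.comp hloglog))).isBigO
    have hdiff : (fun u => quantile P u - vgApprox θ ν u) =O[𝓝[>] (0 : ℝ)]
        (fun u => Real.log |Real.log u| / |Real.log u|) := by
      have h1 : (fun u => 1 / |Real.log u|) =O[𝓝[>] (0 : ℝ)]
          (fun u => Real.log |Real.log u| / |Real.log u|) := by
        simpa only [div_eq_mul_inv] using hone.mul (isBigO_refl (fun u => |Real.log u|⁻¹) (𝓝[>] 0))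
      refine (hexp.sub (happrox.trans h1)).congr_left fun u => ?_
      ring
    have hdiff0 : Tendsto (fun u => quantile P u - vgApprox θ ν u) (𝓝[>] 0) (𝓝 0) :=
      hdiff.trans_tendsto ((Real.isLittleO_log_id_atTop.tendsto_div_nhds_zero).comp hL)
    -- `y (u)` is asymptotic to `-|log u| / c`, since `h (u)` is.
    have hlim : Tendsto (fun u => vgApprox θ ν u / |Real.log u|) (𝓝[>] 0) (𝓝 (-(1 / c))) := by
      have h1 := (tendsto_const_nhds (x := (1 : ℝ))).div
        (tendsto_div_of_isBigO_log_equation ht heq) hc.ne'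
      have h2 := (hdiff0.div_atTop hL).add h1
      refine (h2.neg.congr' ?_).trans (by simp)
      filter_upwards [hL.eventually_gt_atTop 0, ht.eventually_gt_atTop 0] with u hu htu
      simp only [Pi.div_apply]
      have : quantile P u ≠ 0 := by linarith
      field_simp
      ring
    have hyne : ∀ᶠ u in 𝓝[>] (0 : ℝ), vgApprox θ ν u ≠ 0 := by
      filter_upwards [hlim.eventually_ne (neg_ne_zero.2 (one_div_pos.2 hc).ne')] with u hu h0
      exact hu (by simp [h0])
    refine ⟨fun u => (quantile P u - vgApprox θ ν u) / vgApprox θ ν u, ?_, ?_⟩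
    · have hinvy := (hlim.inv₀ (neg_ne_zero.2 (one_div_pos.2 hc).ne')).isBigO_one ℝ
      refine ((hdiff.mul hinvy).mul (isBigO_refl (fun u => |Real.log u|⁻¹) (𝓝[>] 0))).congr' ?_ ?_
      · filter_upwards [hyne, hL.eventually_gt_atTop 0] with u hy hu
        field_simp
      · filter_upwards with u
        rw [← sq_abs (Real.log u)]
        ring
    · filter_upwards [hyne] with u hy
      field_simp
      ring
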